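/- Let $(X,\rho)$ be a compact metric space and let $T\colon X\to X$ be continuous and surjective. A finite family of orbit segments $\xi=\{T^{[a_j,b_j]}(x_j)\}_{j=1}^n$, $n\ge 1$, where $x_j\in X$, $a_j\le b_j$ are nonnegative integers and $T^{[a,b]}(x)=(T^a(x),\ldots,T^b(x))$, is called an $M$-spaced specification, for a function $M$ from the positive integers to the nonnegative integers, if $a_i-b_{i-1}\ge M(b_i-a_i+1)$ for $2\le i\le n$. It is $\varepsilon$-traced by $y\in X$ if $\rho(T^k(y),T^k(x_i))\le\varepsilon$ for all $1\le i\le n$ and $a_i\le k\le b_i$. Suppose that $(X,T)$ has the weak specification property: for every $\varepsilon>0$ there is a nondecreasing function $M_\varepsilon$ from the positive integers to the nonnegative integers with $M_\varepsilon(n)/n\to 0$ as $n\to\infty$ such that every $M_\varepsilon$-spaced specification is $\varepsilon$-traced by some point of $X$. Then $(X,T)$ has the asymptotic average shadowing property: for every sequence $\{x_n\}_{n=0}^\infty$ in $X$ with $$\lim_{N\to\infty}\frac1N\sum_{n=0}^{N-1}\rho\big(T(x_n),x_{n+1}\big)=0$$ there is a point $z\in X$ with $$\lim_{N\to\infty}\frac1N\sum_{n=0}^{N-1}\rho\big(T^n(z),x_n\big)=0.$$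 -/

import Mathlib

open Filter Topology

namespace AverageShadowing

/-- A sequence `x` is an asymptotic average pseudo-orbit for `T` if
`(1 / N) * ∑_{n < N} ρ(T (x n), x (n + 1))` tends to `0`. -/
def IsAsymptoticAveragePseudoOrbit {X : Type*} [MetricSpace X] (T : X → X) (x : ℕ → X) : Prop :=
  Tendsto (fun N : ℕ => (1 / (N : ℝ)) * ∑ n ∈ Finset.range N, dist (T (x n)) (x (n + 1)))
    atTop (𝓝 0)

/-- The sequence `x` is asymptotically shadowed in average by the point `z` if
`(1 / N) * ∑_{n < N} ρ(T^n z, x n)` tends to `0`. -/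
def IsAsymptoticallyShadowedInAverage {X : Type*} [MetricSpace X] (T : X → X) (x : ℕ → X)
    (z : X) : Prop :=
  Tendsto (fun N : ℕ => (1 / (N : ℝ)) * ∑ n ∈ Finset.range N, dist (T^[n] z) (x n))
    atTop (𝓝 0)

/-- The asymptotic average shadowing property. -/
def HasAsymptoticAverageShadowing {X : Type*} [MetricSpace X] (T : X → X) : Prop :=
  ∀ x : ℕ → X, IsAsymptoticAveragePseudoOrbit T x →
    ∃ z : X, IsAsymptoticallyShadowedInAverage T x z

/-- The data `(x, [a, b])`, `a ≤ b`, of an orbit segment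
`T^{[a, b]}(x) = (T^a x, T^(a+1) x, …, T^b x)`. -/
structure OrbitSegment (X : Type*) where
  /-- the point whose orbit is followed -/
  point : X
  /-- the first time of the segment -/
  first : ℕ
  /-- the last time of the segment -/
  last : ℕ
  /-- the time interval is nonempty -/
  first_le_last : first ≤ last

/-- The number `b - a + 1` of terms of an orbit segment over `[a, b]`. -/
def OrbitSegment.length {X : Type*} (s : OrbitSegment X) : ℕ :=
  s.last - s.first + 1

/-- A finite family of orbit segments over `[a_i, b_i]` is an `M`-spaced specification if
`a_i - b_{i-1} ≥ M (b_i - a_i + 1)` (as integers) for every index `i` but the first. -/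
def IsSpacedSpecification {X : Type*} (M : ℕ → ℕ) {n : ℕ} (ξ : Fin n → OrbitSegment X) : Prop :=
  ∀ i j : Fin n, (i : ℕ) + 1 = (j : ℕ) → (ξ i).last + M (ξ j).length ≤ (ξ j).first

/-- The family `ξ` is `ε`-traced by `y`: `ρ(T^k y, T^k x_i) ≤ ε` whenever `a_i ≤ k ≤ b_i`. -/
def IsTracedBy {X : Type*} [MetricSpace X] (T : X → X) (ε : ℝ) {n : ℕ}
    (ξ : Fin n → OrbitSegment X) (y : X) : Prop :=
  ∀ i : Fin n, ∀ k : ℕ, (ξ i).first ≤ k → k ≤ (ξ i).last →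
    dist (T^[k] y) (T^[k] (ξ i).point) ≤ ε

/-- The weak specification property: for each `ε > 0` there is a nondecreasing gap function `M`
with `M n / n → 0` such that every (nonempty, finite) `M`-spaced specification is `ε`-traced by
some point. Replacing `M` by `max M 1`, it does not matter whether `M` may take the value `0`. -/
def HasWeakSpecification {X : Type*} [MetricSpace X] (T : X → X) : Prop :=
  ∀ ε : ℝ, 0 < ε → ∃ M : ℕ → ℕ, Monotone M ∧
    Tendsto (fun n : ℕ => (M n : ℝ) / (n : ℝ)) atTop (𝓝 0) ∧
    ∀ (n : ℕ), 1 ≤ n → ∀ ξ : Fin n → OrbitSegment X, IsSpacedSpecification M ξ →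
      ∃ y : X, IsTracedBy T ε ξ y

end AverageShadowing

namespace AverageShadowing

/-! For fixed `ε`, choose a block length `L` with `M L / L` small and prescribe `x`-based blocks of
length `L` separated by gaps `M L`. Inside a block the true orbit stays near `x`, on average,
because the one-step errors have mean zero; the gaps have small density, so a tracing point follows
`x` in average. The required gap depends only on the length of the segment after it. An arbitrarily
long initial orbit piece can therefore be kept at no extra cost, and `exists_extension` can be
iterated with tolerances `(1 / 2) ^ k` at rapidly growing times. The resulting points form a Cauchy
sequence, and their limit shadows `x`. -/

theorem exists_pos_forall_dist_le (X : Type*) [MetricSpace X] [CompactSpace X] :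
    ∃ D : ℝ, 0 < D ∧ ∀ u v : X, dist u v ≤ D := by
  obtain ⟨D, hD⟩ := Metric.isBounded_iff.1 (isCompact_univ (X := X)).isBounded
  exact ⟨max D 1, by positivity, fun u v =>
    (hD (Set.mem_univ u) (Set.mem_univ v)).trans (le_max_left _ _)⟩

/-- Uniform continuity on a bounded space, in additive form. -/
theorem exists_dist_map_le_add_mul {X : Type*} [MetricSpace X] [CompactSpace X] {T : X → X}
    (hT : Continuous T) {ε : ℝ} (hε : 0 < ε) :
    ∃ C : ℝ, 0 ≤ C ∧ ∀ u v : X, dist (T u) (T v) ≤ ε + C * dist u v := by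
  obtain ⟨D, hD0, hD⟩ := exists_pos_forall_dist_le X
  obtain ⟨δ, hδ, h⟩ := Metric.uniformContinuous_iff.1
    (CompactSpace.uniformContinuous_of_continuous hT) ε hε
  refine ⟨D / δ, by positivity, fun u v => ?_⟩
  rcases lt_or_ge (dist u v) δ with huv | huv
  · have : 0 ≤ D / δ * dist u v := by positivity
    linarith [h huv]
  · have : D ≤ D / δ * dist u v := by
      rw [div_mul_eq_mul_div, le_div_iff₀ hδ]
      exact mul_le_mul_of_nonneg_left huv hD0.le
    linarith [hD (T u) (T v)]

/-- The distance of an orbit from a pseudo-orbit after `j` steps is controlled by the sum of the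
`j` errors made on the way. -/
theorem exists_dist_iterate_le_add_mul_sum {X : Type*} [MetricSpace X] [CompactSpace X]
    {T : X → X} (hT : Continuous T) (x : ℕ → X) (j : ℕ) :
    ∀ ε : ℝ, 0 < ε → ∃ C : ℝ, 0 ≤ C ∧ ∀ a : ℕ, dist (T^[j] (x a)) (x (a + j)) ≤
      ε + C * ∑ t ∈ Finset.range j,
        dist (T (x (a + j - (t + 1)))) (x (a + j - (t + 1) + 1)) := by
  induction j with
  | zero => exact fun ε hε => ⟨0, le_rfl, fun a => by simp [hε.le]⟩
  | succ j ih =>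
    intro ε hε
    obtain ⟨C', hC', h'⟩ := exists_dist_map_le_add_mul hT (half_pos hε)
    -- One more application of `T` multiplies the old tolerance by `C'`; this choice keeps the
    -- product below `ε / 2`, also when `C' = 0`.
    obtain ⟨C, hC, h⟩ := ih (ε / (2 * (C' + 1))) (by positivity)
    refine ⟨C' * C + 1, by positivity, fun a => ?_⟩
    have e1 : ∀ t, a + (j + 1) - (t + 1 + 1) = a + j - (t + 1) := fun t => by omega
    have e2 : a + (j + 1) - (0 + 1) = a + j := by omega
    rw [Finset.sum_range_succ', Function.iterate_succ_apply', e2]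
    simp only [e1]
    set S := ∑ t ∈ Finset.range j, dist (T (x (a + j - (t + 1)))) (x (a + j - (t + 1) + 1))
    have hS : 0 ≤ S := Finset.sum_nonneg fun _ _ => dist_nonneg
    have h1 := dist_triangle (T (T^[j] (x a))) (T (x (a + j))) (x (a + (j + 1)))
    have h2 := h' (T^[j] (x a)) (x (a + j))
    have h3 := mul_le_mul_of_nonneg_left (h a) hC'
    have h4 : C' * (ε / (2 * (C' + 1))) ≤ ε / 2 := by
      rw [mul_div_assoc', div_le_div_iff₀ (by positivity) (by positivity)]
      nlinarith
    have h5 : 0 ≤ C' * C * dist (T (x (a + j))) (x (a + j + 1)) := by positivity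
    rw [← add_assoc] at h1 ⊢
    linarith

/-- At most `m` out of any `P` consecutive integers have residue less than `m` modulo `P`. -/
theorem card_filter_mod_lt_le (P m n : ℕ) :
    ((Finset.range n).filter fun k => k % P < m).card ≤ (n / P + 1) * m := by
  refine (Finset.card_le_card_of_injOn (t := Finset.range (n / P + 1) ×ˢ Finset.range m)
    (fun k => (k / P, k % P)) (fun k hk => ?_) ?_).trans_eq (by simp)
  · simp only [Finset.coe_filter, Finset.mem_range, Set.mem_ofPred_eq] at hk
    simp only [Finset.coe_product, Set.mem_prod, Finset.mem_coe, Finset.mem_range]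
    exact ⟨Nat.lt_succ_of_le (Nat.div_le_div_right hk.1.le), hk.2⟩
  · intro k _ l _ h
    simp only [Prod.mk.injEq] at h
    rw [← Nat.div_add_mod k P, ← Nat.div_add_mod l P, h.1, h.2]

/-- An initial segment of the orbit of `z`, followed by orbit segments of length `L` that start on
the sequence `x` and are separated by gaps of length `M L`, can be traced. -/
theorem exists_tracing_periodic_blocks {X : Type*} [MetricSpace X] {T : X → X}
    (hsurj : Function.Surjective T) {ε : ℝ} {M : ℕ → ℕ}
    (hM : ∀ n : ℕ, 1 ≤ n → ∀ ξ : Fin n → OrbitSegment X, IsSpacedSpecification M ξ →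
      ∃ y : X, IsTracedBy T ε ξ y) {L : ℕ} (hL : 0 < L) (x : ℕ → X) (z : X) (N K : ℕ) :
    ∃ y : X, (∀ k ≤ N, dist (T^[k] y) (T^[k] z) ≤ ε) ∧
      ∀ i < K, ∀ j < L, dist (T^[N + i * (L + M L) + M L + j] y)
        (T^[j] (x (N + i * (L + M L) + M L))) ≤ ε := by
  -- Surjectivity provides a point whose orbit is at `x a` at time `a`.
  choose w hw using fun a : ℕ => hsurj.iterate a (x a)
  let a : ℕ → ℕ := fun i => N + i * (L + M L) + M L
  let ξ : ℕ → OrbitSegment X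
    | 0 => ⟨z, 0, N, N.zero_le⟩
    | i + 1 => ⟨w (a i), a i, a i + (L - 1), by omega⟩
  obtain ⟨y, hy⟩ := hM (K + 1) (by omega) (fun i => ξ i) (by
    rintro ⟨i, hi⟩ ⟨j, hj⟩ h
    obtain rfl : i + 1 = j := h
    have hlen : (ξ (i + 1)).length = L := by
      simp only [ξ, OrbitSegment.length]; omega
    show (ξ i).last + M (ξ (i + 1)).length ≤ (ξ (i + 1)).first
    rw [hlen]
    cases i with
    | zero => simp [ξ, a]
    | succ i =>
      simp only [ξ, a]
      have : (i + 1) * (L + M L) = i * (L + M L) + (L + M L) := by ring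
      omega)
  refine ⟨y, fun k hk => hy ⟨0, by omega⟩ k (Nat.zero_le _) hk, fun i hi j hj => ?_⟩
  have := hy ⟨i + 1, by omega⟩ (a i + j) (Nat.le_add_right _ _)
    (show a i + j ≤ a i + (L - 1) by omega)
  rwa [show (ξ (i + 1)).point = w (a i) from rfl, add_comm (a i) j,
    Function.iterate_add_apply T j (a i) (w (a i)), hw, add_comm j] at this

/-- Beyond a threshold, the orbit of any point may be modified after time `N₁` so that it follows
the pseudo-orbit `x` in average up to time `N₂`. -/
theorem exists_extension {X : Type*} [MetricSpace X] [CompactSpace X] {T : X → X}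
    (hT : Continuous T) (hsurj : Function.Surjective T) (hspec : HasWeakSpecification T)
    {x : ℕ → X} (hx : IsAsymptoticAveragePseudoOrbit T x) {ε : ℝ} (hε : 0 < ε) :
    ∃ N₀ : ℕ, ∀ N₁ ≥ N₀, ∀ (N₂ : ℕ) (z : X), ∃ y : X,
      (∀ k ≤ N₁, dist (T^[k] y) (T^[k] z) ≤ ε) ∧
      ∀ N, N₁ ≤ N → N ≤ N₂ → ∑ n ∈ Finset.Ico N₁ N, dist (T^[n] y) (x n) ≤ ε * N := by
  obtain ⟨D, hD0, hD⟩ := exists_pos_forall_dist_le X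
  obtain ⟨M, -, hMlim, hM⟩ := hspec (ε / 4) (by positivity)
  obtain ⟨L, hLM, hL⟩ := ((hMlim.eventually_le_const
    (show (0 : ℝ) < ε / (8 * D) by positivity)).and (eventually_gt_atTop 0)).exists
  have hL' : (0 : ℝ) < L := by exact_mod_cast hL
  rw [div_le_div_iff₀ hL' (by positivity)] at hLM
  choose C' hC'0 hC' using fun j => exists_dist_iterate_le_add_mul_sum hT x j (ε / 4) (by positivity)
  set C := ∑ j ∈ Finset.range L, C' j with hC
  have hC0 : 0 ≤ C := Finset.sum_nonneg fun j _ => hC'0 j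
  set e : ℕ → ℝ := fun n => dist (T (x n)) (x (n + 1)) with he
  have he0 : ∀ n, 0 ≤ e n := fun n => dist_nonneg
  -- Errors are indexed backwards from `a + j`, so the bound depends only on the current time and
  -- not on where its block began.
  have hwin : ∀ a, ∀ j < L, dist (T^[j] (x a)) (x (a + j)) ≤
      ε / 4 + C * ∑ t ∈ Finset.range L, e (a + j - (t + 1)) := by
    intro a j hj
    refine (hC' j a).trans (add_le_add_right (mul_le_mul ?_ ?_ ?_ hC0) _)
    · exact Finset.single_le_sum (fun j _ => hC'0 j) (Finset.mem_range.2 hj)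
    · exact Finset.sum_le_sum_of_subset_of_nonneg (Finset.range_mono hj.le) fun _ _ _ => he0 _
    · exact Finset.sum_nonneg fun _ _ => dist_nonneg
  have hS := hx.eventually_le_const (show (0 : ℝ) < ε / (4 * (C * L + 1)) by positivity)
  -- `L + 1` keeps the subtraction `n - (t + 1)` from truncating; the last threshold absorbs the gap
  -- of an incomplete final period.
  obtain ⟨N₀, hN₀⟩ := eventually_atTop.1 (hS.and ((eventually_ge_atTop (L + 1)).and
    (eventually_ge_atTop ⌈8 * D * M L / ε⌉₊)))
  refine ⟨N₀, fun N₁ hN₁ N₂ z => ?_⟩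
  -- `N₂` blocks are more than enough to reach time `N₂`.
  obtain ⟨y, hy1, hy2⟩ := exists_tracing_periodic_blocks hsurj hM hL x z N₁ N₂
  refine ⟨y, fun k hk => (hy1 k hk).trans (by linarith), fun N hN hN' => ?_⟩
  obtain ⟨hSN, -, hmN⟩ := hN₀ N (hN₁.le.trans hN)
  have hLN := (hN₀ N₁ hN₁).2.1
  have hNpos : (0 : ℝ) < N := by exact_mod_cast (by omega : 0 < N)
  set P := L + M L with hP
  have hpt : ∀ n ∈ Finset.Ico N₁ N, dist (T^[n] y) (x n) ≤
      ε / 2 + (if (n - N₁) % P < M L then D else 0) +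
        C * ∑ t ∈ Finset.range L, e (n - (t + 1)) := by
    intro n hn
    rw [Finset.mem_Ico] at hn
    have hs : 0 ≤ C * ∑ t ∈ Finset.range L, e (n - (t + 1)) :=
      mul_nonneg hC0 (Finset.sum_nonneg fun _ _ => he0 _)
    split_ifs with hr
    · linarith [hD (T^[n] y) (x n)]
    · have hmod : (n - N₁) % P < P := Nat.mod_lt _ (by omega)
      have hdm := Nat.div_add_mod' (n - N₁) P
      have hdiv : (n - N₁) / P ≤ n - N₁ := Nat.div_le_self _ _
      obtain ⟨j, hj⟩ := Nat.exists_eq_add_of_le (not_lt.1 hr)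
      have hjL : j < L := by omega
      have hn' : N₁ + (n - N₁) / P * P + M L + j = n := by omega
      have h1 := hy2 ((n - N₁) / P) (by omega) j hjL
      have h2 := hwin (N₁ + (n - N₁) / P * P + M L) j hjL
      rw [hn'] at h1 h2
      linarith [dist_triangle (T^[n] y) (T^[j] (x (N₁ + (n - N₁) / P * P + M L))) (x n)]
  have hgap : ∑ n ∈ Finset.Ico N₁ N, (if (n - N₁) % P < M L then D else 0) ≤ ε / 4 * N := by
    rw [Finset.sum_Ico_eq_sum_range]
    simp only [Nat.add_sub_cancel_left]
    rw [← Finset.sum_filter, Finset.sum_const, nsmul_eq_mul]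
    have h1 : (((Finset.range (N - N₁)).filter fun k => k % P < M L).card : ℝ) ≤
        ((N - N₁) / P + 1 : ℕ) * M L := by
      exact_mod_cast card_filter_mod_lt_le P (M L) (N - N₁)
    have h2 : ((((N - N₁) / P : ℕ) : ℝ)) * L ≤ N := by
      have : (N - N₁) / P * L ≤ N := calc
        _ ≤ (N - N₁) / P * P := Nat.mul_le_mul_left _ (by omega)
        _ ≤ N - N₁ := Nat.div_mul_le_self _ _
        _ ≤ N := Nat.sub_le _ _
      exact_mod_cast this
    have h3 : 8 * D * M L / ε ≤ N := Nat.ceil_le.1 hmN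
    rw [div_le_iff₀ hε] at h3
    push_cast at h1
    set q : ℝ := (((N - N₁) / P : ℕ) : ℝ)
    have hq : 0 ≤ q := Nat.cast_nonneg _
    have h4 := mul_le_mul_of_nonneg_left hLM hq
    have h5 := mul_le_mul_of_nonneg_left h2 hε.le
    have h6 := mul_le_mul_of_nonneg_right h1 hD0.le
    linarith
  have herr : ∑ n ∈ Finset.Ico N₁ N, C * ∑ t ∈ Finset.range L, e (n - (t + 1)) ≤ ε / 4 * N := by
    -- After the swap, each of the `L` shifts contributes at most the total error up to `N`.
    rw [← Finset.mul_sum, Finset.sum_comm]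
    have h1 : ∀ t ∈ Finset.range L, ∑ n ∈ Finset.Ico N₁ N, e (n - (t + 1)) ≤
        ∑ n ∈ Finset.range N, e n := by
      intro t ht
      rw [Finset.mem_range] at ht
      rw [← Finset.sum_image (g := fun n => n - (t + 1)) (f := e)]
      · refine Finset.sum_le_sum_of_subset_of_nonneg (fun k hk => ?_) fun _ _ _ => he0 _
        obtain ⟨n, hn, rfl⟩ := Finset.mem_image.1 hk
        rw [Finset.mem_Ico] at hn
        exact Finset.mem_range.2 (by omega)
      · intro n hn n' hn' h
        simp only [Finset.coe_Ico, Set.mem_Ico] at hn hn' h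
        omega
    have h2 := Finset.sum_le_sum h1
    rw [Finset.sum_const, Finset.card_range, nsmul_eq_mul] at h2
    have h3 : ∑ n ∈ Finset.range N, e n ≤ ε / (4 * (C * L + 1)) * N := by
      rw [one_div, inv_mul_le_iff₀ hNpos] at hSN
      linarith
    have hCL : 0 ≤ C * L := by positivity
    calc _ ≤ C * (L * ∑ n ∈ Finset.range N, e n) := mul_le_mul_of_nonneg_left h2 hC0
      _ = C * L * ∑ n ∈ Finset.range N, e n := by ring
      _ ≤ C * L * (ε / (4 * (C * L + 1)) * N) := mul_le_mul_of_nonneg_left h3 hCL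
      _ = C * L * (ε / (4 * (C * L + 1))) * N := by ring
      _ ≤ ε / 4 * N := by
        refine mul_le_mul_of_nonneg_right ?_ hNpos.le
        rw [mul_div_assoc', div_le_div_iff₀ (by positivity) (by positivity)]
        nlinarith
  have hsum := Finset.sum_le_sum hpt
  rw [Finset.sum_add_distrib, Finset.sum_add_distrib, Finset.sum_const, Nat.card_Ico,
    nsmul_eq_mul] at hsum
  have hc : ((N - N₁ : ℕ) : ℝ) * (ε / 2) ≤ N * (ε / 2) := by
    refine mul_le_mul_of_nonneg_right ?_ (by positivity)
    exact_mod_cast Nat.sub_le _ _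
  linarith

end AverageShadowing

open AverageShadowing in
theorem mainTheorem3 {X : Type*} [MetricSpace X] [CompactSpace X] (T : X → X)
    (hT : Continuous T) (hsurj : Function.Surjective T)
    (hspec : AverageShadowing.HasWeakSpecification T) :
    AverageShadowing.HasAsymptoticAverageShadowing T := by
  intro x hx
  obtain ⟨D, hD0, hD⟩ := exists_pos_forall_dist_le X
  choose N₀ hext using fun k : ℕ => exists_extension hT hsurj hspec hx
    (show (0 : ℝ) < (1 / 2) ^ k by positivity)
  -- The term `2 ^ k * t k` makes the times before `t k` negligible at `t (k + 1)`.
  obtain ⟨t, ht0, ht⟩ : ∃ t : ℕ → ℕ, t 0 = N₀ 0 ∧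
      ∀ k, t (k + 1) = N₀ (k + 1) + 2 ^ k * t k + t k + 1 :=
    ⟨fun k => Nat.rec (N₀ 0) (fun k n => N₀ (k + 1) + 2 ^ k * n + n + 1) k, rfl, fun _ => rfl⟩
  have htN : ∀ k, N₀ k ≤ t k
    | 0 => ht0.ge
    | k + 1 => by rw [ht]; omega
  have htmono : StrictMono t := strictMono_nat_of_lt_succ fun k => by rw [ht]; omega
  have hgrow : ∀ k : ℕ, (t k : ℝ) ≤ (1 / 2) ^ k * t (k + 1) := by
    intro k
    have : 2 ^ k * t k ≤ t (k + 1) := by rw [ht]; omega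
    have : (2 : ℝ) ^ k * t k ≤ t (k + 1) := by exact_mod_cast this
    rw [one_div, inv_pow, le_inv_mul_iff₀ (by positivity)]
    exact this
  choose g hg1 hg2 using fun k => hext k (t k) (htN k) (t (k + 1))
  let z : ℕ → X := Nat.rec (x 0) fun k w => g k w
  have hz1 : ∀ k, ∀ n ≤ t k, dist (T^[n] (z (k + 1))) (T^[n] (z k)) ≤ (1 / 2) ^ k :=
    fun k => hg1 k (z k)
  have hz2 : ∀ k N, t k ≤ N → N ≤ t (k + 1) →
      ∑ n ∈ Finset.Ico (t k) N, dist (T^[n] (z (k + 1))) (x n) ≤ (1 / 2) ^ k * N :=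
    fun k => hg2 k (z k)
  obtain ⟨y, hy⟩ := cauchySeq_tendsto_of_complete (cauchySeq_of_le_geometric (f := z) (1 / 2) 1
    (by norm_num) fun k => by
      rw [one_mul, dist_comm]; exact hz1 k 0 (Nat.zero_le _))
  have hlim : ∀ k, ∀ n ≤ t (k + 1), dist (T^[n] (z (k + 1))) (T^[n] y) ≤ (1 / 2) ^ k := by
    intro k n hn
    have hconv : Tendsto (fun j => T^[n] (z (j + (k + 1)))) atTop (𝓝 (T^[n] y)) :=
      (((hT.iterate n).tendsto y).comp hy).comp (tendsto_add_atTop_nat (k + 1))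
    have := dist_le_of_le_geometric_two_of_tendsto₀ (C := (1 / 2 : ℝ) ^ k) (fun j => ?_) hconv
    · simpa using this
    · rw [dist_comm, show j + 1 + (k + 1) = j + (k + 1) + 1 by ring]
      refine (hz1 _ n (hn.trans (htmono.monotone (by omega)))).trans (le_of_eq ?_)
      rw [pow_add, pow_succ (1 / 2 : ℝ) k, one_div, inv_pow]
      ring
  set E : ℕ → ℝ := fun N => ∑ n ∈ Finset.range N, dist (T^[n] y) (x n) with hE
  have hstep : ∀ k N, t k ≤ N → N ≤ t (k + 1) → E N ≤ E (t k) + 2 * (1 / 2) ^ k * N := by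
    intro k N h1 h2
    have hsplit : E N = E (t k) + ∑ n ∈ Finset.Ico (t k) N, dist (T^[n] y) (x n) :=
      (Finset.sum_range_add_sum_Ico _ h1).symm
    have hle : ∑ n ∈ Finset.Ico (t k) N, dist (T^[n] y) (x n) ≤
        ∑ n ∈ Finset.Ico (t k) N, ((1 / 2) ^ k + dist (T^[n] (z (k + 1))) (x n)) := by
      refine Finset.sum_le_sum fun n hn => (dist_triangle_left _ _ (T^[n] (z (k + 1)))).trans
        (add_le_add_left (hlim k n ?_) _)
      exact (Finset.mem_Ico.1 hn).2.le.trans h2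
    rw [Finset.sum_add_distrib, Finset.sum_const, Nat.card_Ico, nsmul_eq_mul] at hle
    have hc : ((N - t k : ℕ) : ℝ) * (1 / 2) ^ k ≤ N * (1 / 2) ^ k := by
      refine mul_le_mul_of_nonneg_right ?_ (by positivity)
      exact_mod_cast Nat.sub_le _ _
    linarith [hz2 k N h1 h2]
  have hED : ∀ N, E N ≤ N * D := fun N => by
    simpa using Finset.sum_le_card_nsmul (Finset.range N) _ D fun n _ => hD (T^[n] y) (x n)
  -- Two stages are unwound: only the sum up to `t k` gets the trivial bound `D * t k`, which is
  -- small relative to `t (k + 1) ≤ N`.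
  have hblock : ∀ k N, t (k + 1) ≤ N → N ≤ t (k + 2) → E N ≤ (D + 4) * (1 / 2) ^ k * N := by
    intro k N h1 h2
    have a1 := hstep (k + 1) N h1 h2
    have a2 := hstep k (t (k + 1)) (htmono.monotone k.le_succ) le_rfl
    have a3 := mul_le_mul_of_nonneg_right (hgrow k) hD0.le
    have a4 : (D + 2) * (1 / 2) ^ k * (t (k + 1) : ℝ) ≤ (D + 2) * (1 / 2) ^ k * N :=
      mul_le_mul_of_nonneg_left (by exact_mod_cast h1) (by positivity)
    have a5 : (0 : ℝ) ≤ (1 / 2) ^ k * N := by positivity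
    rw [pow_succ] at a1
    linarith [hED (t k)]
  have hall : ∀ K j N, t (K + 1) ≤ N → N ≤ t (K + 1 + j) → E N ≤ (D + 4) * (1 / 2) ^ K * N := by
    intro K j
    induction j with
    | zero => exact fun N h1 h2 => hblock K N h1 (h2.trans (htmono.monotone (by omega)))
    | succ j ih =>
      intro N h1 h2
      rcases le_total N (t (K + 1 + j)) with h | h
      · exact ih N h1 h
      · refine (hblock (K + j) N (by rwa [add_right_comm]) ?_).trans ?_
        · rwa [show K + j + 2 = K + 1 + (j + 1) by ring]
        · refine mul_le_mul_of_nonneg_right (mul_le_mul_of_nonneg_left ?_ (by positivity))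
            (Nat.cast_nonneg _)
          exact pow_le_pow_of_le_one (by norm_num) (by norm_num) (by omega)
  refine ⟨y, ?_⟩
  have hgeo : Tendsto (fun K : ℕ => (D + 4) * (1 / 2 : ℝ) ^ K) atTop (𝓝 0) := by
    simpa using (tendsto_pow_atTop_nhds_zero_of_lt_one (r := (1 / 2 : ℝ)) (by norm_num)
      (by norm_num)).const_mul (D + 4)
  refine Metric.tendsto_atTop.2 fun δ hδ => ?_
  obtain ⟨K, hK⟩ := (hgeo.eventually_lt_const hδ).exists
  refine ⟨t (K + 1), fun N hN => ?_⟩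
  have hNpos : (0 : ℝ) < N := by
    have := ht K
    exact_mod_cast (by omega : 0 < N)
  have hEN := hall K N N hN ((Nat.le_add_left _ _).trans htmono.le_apply)
  rw [Real.dist_0_eq_abs, abs_of_nonneg
    (mul_nonneg (by positivity) (Finset.sum_nonneg fun _ _ => dist_nonneg)), one_div,
    inv_mul_lt_iff₀ hNpos]
  exact hEN.trans_lt (by rw [mul_comm]; exact mul_lt_mul_of_pos_left hK hNpos)
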